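/- Let $\Delta\ge 2$ be an integer and let $G$ be a finite bipartite simple graph in which every node has degree at most $\Delta$. A greedy matching algorithm starts with the empty edge set and, as long as possible, picks an edge of the current reduced graph, i.e. of the graph whose edges are the edges of $G$ not incident with any node covered by a previously picked edge; it stops and returns the set of picked edges when the reduced graph has no edge. The KarpSipser algorithm picks in each round an edge incident with a node that has degree one in the reduced graph, if such a node exists, and an arbitrary edge of the reduced graph otherwise. The MinGreedy algorithm selects in each round a node of minimum degree among the non-isolated nodes of the reduced graph and matches it with an arbitrary neighbor in the reduced graph. All ties may be broken in an arbitrary (worst-case) way. Then, no matter how ties are broken, the KarpSipser algorithm terminates on $G$ and returns a matching of $G$ of size at least $\frac{\Delta}{2\Delta-2}$ times the size of a maximum matching of $G$. The same holds for the MinGreedy algorithm. -/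

import Mathlib

namespace GreedyMatching

variable {V : Type*}

/-- The reduced graph: the edges of `G` neither of whose endpoints is covered by an edge
in `M`, the set of edges picked so far. -/
def reduced (G : SimpleGraph V) (M : Finset (Sym2 V)) : SimpleGraph V where
  Adj u v := G.Adj u v ∧ (∀ e ∈ M, u ∉ e) ∧ (∀ e ∈ M, v ∉ e)
  symm := ⟨fun _ _ h => ⟨h.1.symm, h.2.2, h.2.1⟩⟩
  loopless := ⟨fun _ h => G.loopless.irrefl _ h.1⟩

/-- A selection rule: `rule H u v` says that the algorithm may pick the edge `uv` when the
current reduced graph is `H`. Ties are broken arbitrarily: every permitted pick is possible. -/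
abbrev Rule (V : Type*) := SimpleGraph V → V → V → Prop

open Classical in
/-- The Karp–Sipser rule: pick an edge incident with a node of degree one if there is such a
node, and an arbitrary edge otherwise. -/
def karpSipser [Fintype V] : Rule V := fun H u v =>
  H.Adj u v ∧ ((∃ w, H.degree w = 1) → H.degree u = 1 ∨ H.degree v = 1)

open Classical in
/-- The MinGreedy rule: select a node `u` of minimum degree among the non-isolated nodes and
match it with an arbitrary neighbor `v`. -/
def minGreedy [Fintype V] : Rule V := fun H u v =>
  H.Adj u v ∧ ∀ w, 0 < H.degree w → H.degree u ≤ H.degree w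

/-- `Reachable rule G M`: on input `G` some run of the algorithm with the given selection rule
has, after finitely many rounds, picked exactly the edges in `M`. -/
inductive Reachable [DecidableEq V] (rule : Rule V) (G : SimpleGraph V) :
    Finset (Sym2 V) → Prop
  | start : Reachable rule G ∅
  | pick {M : Finset (Sym2 V)} {u v : V} : Reachable rule G M → rule (reduced G M) u v →
      Reachable rule G (insert s(u, v) M)

/-- `Output rule G M`: on input `G` some run of the algorithm returns `M`. A run ends when the
reduced graph has no edges left. -/
def Output [DecidableEq V] (rule : Rule V) (G : SimpleGraph V) (M : Finset (Sym2 V)) : Prop :=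
  Reachable rule G M ∧ reduced G M = ⊥

/-- The edge set `M` is a matching of `G`. -/
def IsMatchingOf (G : SimpleGraph V) (M : Finset (Sym2 V)) : Prop :=
  ∃ S : G.Subgraph, S.IsMatching ∧ S.edgeSet = (M : Set (Sym2 V))

/-- Under worst-case tie breaking, the algorithm with the given selection rule computes on `G`
a matching of size at least `r` times the size of a maximum matching: a run can always be
continued until it returns an edge set, and every edge set that can be returned is a matching
with at least `r * |N|` edges for each matching `N` of `G`. -/
def Guarantees [DecidableEq V] (rule : Rule V) (G : SimpleGraph V) (r : ℚ) : Prop :=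
  (∀ M, Reachable rule G M → ∃ M', M ⊆ M' ∧ Output rule G M') ∧
  ∀ M, Output rule G M →
    IsMatchingOf G M ∧ ∀ N : Finset (Sym2 V), IsMatchingOf G N → r * N.card ≤ M.card

end GreedyMatching

namespace GreedyMatching

/-! ### Runs of the algorithms, edges lost per pick, dead nodes -/

section General

variable {V : Type*}

/-! Every MinGreedy pick is a legal Karp–Sipser pick, so only the latter rule needs a bound. Put `e
= Δ - 2`, and call a pick free if the reduced graph has no node of degree one. A free pick destroys
at most two edges of a competing matching `N`, any other pick at most one. With `p` free picks, `|N|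
≤ |M| + p`.

A second bound counts nodes. Let `a` nodes be dead just before the first free pick. No edge has been
lost by then, so `2|N| + a ≤ |V|`. At the end every node is covered or dead. If `m` degree-one picks
follow the first free pick and at most `a + e * m` nodes are dead at the end, then `2|N| ≤ 2|M| + e
* m`. Adding `e` times the first bound and using `p + m ≤ |M|` gives `(e + 2)|N| ≤ (2e + 2)|M|`.

The crux is that a degree-one pick accounts for only `e` dead nodes, although it may kill `e + 1` at
once (`Balanced.le`). For this, the deficit is tracked separately in each colour class. It is twice
the number of dead nodes before a free pick, grows by at most `e + 1` at a free pick, and by at most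
`e` when a degree-one node of that colour is picked. -/

theorem minGreedy.karpSipser [Fintype V] {H : SimpleGraph V} {u v : V} (h : minGreedy H u v) :
    karpSipser H u v := by
  classical
  refine ⟨h.1, fun ⟨w, hw⟩ => Or.inl (le_antisymm ?_ ?_)⟩
  · have := h.2 w (by omega)
    omega
  · exact (H.degree_pos_iff_exists_adj u).2 ⟨v, h.1⟩

theorem exists_minGreedy [Fintype V] {H : SimpleGraph V} (h : H ≠ ⊥) :
    ∃ u v, minGreedy H u v := by
  classical
  obtain ⟨a, b, hab⟩ := SimpleGraph.ne_bot_iff_exists_adj.1 h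
  obtain ⟨u, hu, hmin⟩ := Finset.exists_min_image
    (Finset.univ.filter fun w => 0 < H.degree w) (fun w => H.degree w)
    ⟨a, by simpa using (H.degree_pos_iff_exists_adj a).2 ⟨b, hab⟩⟩
  obtain ⟨v, hv⟩ := (H.degree_pos_iff_exists_adj u).1 (Finset.mem_filter.1 hu).2
  refine ⟨u, v, hv, fun w hw => ?_⟩
  convert hmin w (by simp only [Finset.mem_filter, Finset.mem_univ, true_and]; convert hw)

theorem Reachable.mono [DecidableEq V] {r r' : Rule V} (h : ∀ H u v, r H u v → r' H u v)
    {G : SimpleGraph V} {M : Finset (Sym2 V)} (hM : Reachable r G M) : Reachable r' G M := by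
  induction hM with
  | start => exact .start
  | pick _ hr ih => exact .pick ih (h _ _ _ hr)

/-- The node `w` is not covered by any edge in `M`. -/
def Uncovered (M : Finset (Sym2 V)) (w : V) : Prop := ∀ e ∈ M, w ∉ e

theorem uncovered_insert [DecidableEq V] {M : Finset (Sym2 V)} {u v w : V} :
    Uncovered (insert s(u, v) M) w ↔ w ≠ u ∧ w ≠ v ∧ Uncovered M w := by
  simp [Uncovered, and_assoc]

theorem reduced_adj {G : SimpleGraph V} {M : Finset (Sym2 V)} {a b : V} :
    (reduced G M).Adj a b ↔ G.Adj a b ∧ Uncovered M a ∧ Uncovered M b := Iff.rfl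

theorem exists_output [Fintype V] [DecidableEq V] {r : Rule V}
    (hr : ∀ H : SimpleGraph V, H ≠ ⊥ → ∃ u v, r H u v) (hadj : ∀ H u v, r H u v → H.Adj u v)
    {G : SimpleGraph V} {M : Finset (Sym2 V)} (hM : Reachable r G M) :
    ∃ M', M ⊆ M' ∧ Output r G M' := by
  classical
  induction hn : (Finset.univ.filter (Uncovered M)).card using Nat.strong_induction_on
    generalizing M with
  | _ n ih =>
    by_cases hbot : reduced G M = ⊥
    · exact ⟨M, subset_rfl, hM, hbot⟩
    obtain ⟨u, v, huv⟩ := hr _ hbot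
    have hlt : (Finset.univ.filter (Uncovered (insert s(u, v) M))).card < n := by
      rw [← hn]
      refine Finset.card_lt_card (Finset.ssubset_iff_of_subset ?_ |>.2 ⟨u, ?_, ?_⟩)
      · intro w
        simp only [Finset.mem_filter, Finset.mem_univ, true_and, uncovered_insert]
        exact fun h => h.2.2
      · exact Finset.mem_filter.2 ⟨Finset.mem_univ _, (reduced_adj.1 (hadj _ _ _ huv)).2.1⟩
      · simp [uncovered_insert]
    obtain ⟨M', h, h'⟩ := ih _ hlt (hM.pick huv) rfl
    exact ⟨M', (Finset.subset_insert _ _).trans h, h'⟩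

/-- The edges in `M` are edges of `G` no two of which share a node. -/
def IsEdgeMatching (G : SimpleGraph V) (M : Finset (Sym2 V)) : Prop :=
  (∀ e ∈ M, e ∈ G.edgeSet) ∧ ∀ e ∈ M, ∀ e' ∈ M, ∀ w, w ∈ e → w ∈ e' → e = e'

theorem IsMatchingOf.isEdgeMatching {G : SimpleGraph V} {M : Finset (Sym2 V)}
    (h : IsMatchingOf G M) : IsEdgeMatching G M := by
  obtain ⟨S, hS, hM⟩ := h
  have hmem : ∀ e, e ∈ M ↔ e ∈ S.edgeSet := fun e => by simp [hM]
  refine ⟨fun e he => S.edgeSet_subset ((hmem e).1 he), fun e he e' he' w hw hw' => ?_⟩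
  obtain ⟨a, rfl⟩ := Sym2.mem_iff_exists.1 hw
  obtain ⟨b, rfl⟩ := Sym2.mem_iff_exists.1 hw'
  have ha : S.Adj w a := (hmem _).1 he
  have hb : S.Adj w b := (hmem _).1 he'
  rw [(hS ha.fst_mem).unique ha hb]

theorem IsEdgeMatching.isMatchingOf {G : SimpleGraph V} {M : Finset (Sym2 V)}
    (h : IsEdgeMatching G M) : IsMatchingOf G M := by
  refine ⟨{ verts := {w | ∃ e ∈ M, w ∈ e}, Adj := fun a b => s(a, b) ∈ M,
            adj_sub := fun hab => h.1 _ hab, edge_vert := fun hab => ⟨_, hab, by simp⟩,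
            symm := ⟨fun a b hab => by rwa [Sym2.eq_swap]⟩ }, ?_, ?_⟩
  · rintro w ⟨e, he, hw⟩
    obtain ⟨a, rfl⟩ := Sym2.mem_iff_exists.1 hw
    refine ⟨a, he, fun b hb => ?_⟩
    exact Sym2.congr_right.1 (h.2 _ hb _ he w (by simp) (by simp))
  · ext e
    induction e with
    | _ a b => rfl

theorem isEdgeMatching_empty (G : SimpleGraph V) : IsEdgeMatching G ∅ := by
  simp [IsEdgeMatching]

theorem IsEdgeMatching.insert_pick [DecidableEq V] {G : SimpleGraph V} {M : Finset (Sym2 V)}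
    (h : IsEdgeMatching G M) {u v : V} (huv : (reduced G M).Adj u v) :
    IsEdgeMatching G (insert s(u, v) M) := by
  have key : ∀ e ∈ M, ∀ w, w ∈ s(u, v) → w ∉ e := by
    intro e he w hw
    rcases Sym2.mem_iff.1 hw with rfl | rfl
    exacts [huv.2.1 e he, huv.2.2 e he]
  refine ⟨fun e he => ?_, fun e he e' he' w hw hw' => ?_⟩
  · rcases Finset.mem_insert.1 he with rfl | he
    exacts [huv.1, h.1 e he]
  · rcases Finset.mem_insert.1 he with rfl | he <;> rcases Finset.mem_insert.1 he' with rfl | he'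
    · rfl
    · exact absurd hw' (key _ he' w hw)
    · exact absurd hw (key _ he w hw')
    · exact h.2 e he e' he' w hw hw'

theorem card_insert_pick [DecidableEq V] {G : SimpleGraph V} {M : Finset (Sym2 V)} {u v : V}
    (huv : (reduced G M).Adj u v) : (insert s(u, v) M).card = M.card + 1 :=
  Finset.card_insert_of_notMem fun h => huv.2.1 _ h (by simp)

theorem IsEdgeMatching.union [DecidableEq V] {G : SimpleGraph V} {M N : Finset (Sym2 V)}
    (hM : IsEdgeMatching G M) (hN : IsEdgeMatching (reduced G M) N) :
    IsEdgeMatching G (M ∪ N) ∧ Disjoint M N := by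
  have key : ∀ e ∈ N, ∀ w ∈ e, Uncovered M w := by
    intro e he w hw
    obtain ⟨a, rfl⟩ := Sym2.mem_iff_exists.1 hw
    exact (reduced_adj.1 (hN.1 _ he)).2.1
  refine ⟨⟨fun e he => ?_, fun e he e' he' w hw hw' => ?_⟩, ?_⟩
  · rcases Finset.mem_union.1 he with he | he
    · exact hM.1 e he
    · induction e with
      | _ a b => exact (reduced_adj.1 (hN.1 _ he)).1
  · rcases Finset.mem_union.1 he with he | he <;> rcases Finset.mem_union.1 he' with he' | he'
    · exact hM.2 e he e' he' w hw hw'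
    · exact absurd hw (key _ he' w hw' e he)
    · exact absurd hw' (key _ he w hw e' he')
    · exact hN.2 e he e' he' w hw hw'
  · refine Finset.disjoint_left.2 fun e he he' => ?_
    induction e with
    | _ a b => exact key _ he' a (by simp) _ he (by simp)

/-- Removing the endpoints of an edge destroys at most two edges of a matching, and only one if
an endpoint has no further neighbor. -/
theorem IsEdgeMatching.exists_insert [DecidableEq V] {G : SimpleGraph V} {M N : Finset (Sym2 V)}
    (hN : IsEdgeMatching (reduced G M) N) (u v : V) :
    ∃ N', IsEdgeMatching (reduced G (insert s(u, v) M)) N' ∧ N.card ≤ N'.card + 2 ∧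
      ((∀ x, (reduced G M).Adj u x → x = v) → N.card ≤ N'.card + 1) := by
  have one : ∀ w : V, (N.filter fun e => w ∈ e).card ≤ 1 := fun w =>
    Finset.card_le_one.2 fun e he e' he' =>
      hN.2 e (Finset.mem_filter.1 he).1 e' (Finset.mem_filter.1 he').1 w
        (Finset.mem_filter.1 he).2 (Finset.mem_filter.1 he').2
  have split := Finset.card_filter_add_card_filter_not (s := N) fun e => u ∉ e ∧ v ∉ e
  refine ⟨N.filter fun e => u ∉ e ∧ v ∉ e, ⟨fun e he => ?_, fun e he e' he' =>
    hN.2 e (Finset.mem_filter.1 he).1 e' (Finset.mem_filter.1 he').1⟩, ?_, fun hu => ?_⟩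
  · obtain ⟨he, hu, hv⟩ := Finset.mem_filter.1 he
    induction e with
    | _ a b =>
      have hab := reduced_adj.1 (hN.1 _ he)
      simp only [Sym2.mem_iff, not_or] at hu hv
      exact reduced_adj.2 ⟨hab.1, uncovered_insert.2 ⟨Ne.symm hu.1, Ne.symm hv.1, hab.2.1⟩,
        uncovered_insert.2 ⟨Ne.symm hu.2, Ne.symm hv.2, hab.2.2⟩⟩
  · have : (N.filter fun e => ¬ (u ∉ e ∧ v ∉ e)) ⊆
        (N.filter fun e => u ∈ e) ∪ N.filter fun e => v ∈ e := by
      intro e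
      simp only [Finset.mem_filter, Finset.mem_union]
      tauto
    have := (Finset.card_le_card this).trans (Finset.card_union_le _ _)
    have := one u
    have := one v
    omega
  · have : (N.filter fun e => ¬ (u ∉ e ∧ v ∉ e)) ⊆ N.filter fun e => v ∈ e := by
      intro e he
      obtain ⟨he, h⟩ := Finset.mem_filter.1 he
      refine Finset.mem_filter.2 ⟨he, ?_⟩
      by_contra hv
      have hue : u ∈ e := by tauto
      obtain ⟨x, rfl⟩ := Sym2.mem_iff_exists.1 hue
      exact hv (by simp [hu x (hN.1 _ he)])
    have := Finset.card_le_card this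
    have := one v
    omega

/-- Every matching of `G` can be replaced by a matching of the reduced graph, and at most
`M.card + p` edges are lost. -/
def LosesAtMost (G : SimpleGraph V) (M : Finset (Sym2 V)) (p : ℕ) : Prop :=
  ∀ N, IsEdgeMatching G N → ∃ N', IsEdgeMatching (reduced G M) N' ∧
    N.card ≤ M.card + p + N'.card

theorem losesAtMost_empty (G : SimpleGraph V) : LosesAtMost G ∅ 0 := fun N hN =>
  ⟨N, ⟨fun e he => by
    induction e with
    | _ a b => exact reduced_adj.2 ⟨hN.1 _ he, by simp [Uncovered], by simp [Uncovered]⟩, hN.2⟩,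
    by simp⟩

theorem LosesAtMost.pick [DecidableEq V] {G : SimpleGraph V} {M : Finset (Sym2 V)} {p : ℕ}
    (h : LosesAtMost G M p) {u v : V} (huv : (reduced G M).Adj u v) :
    LosesAtMost G (insert s(u, v) M) (p + 1) := fun N hN => by
  obtain ⟨N', hN', hle⟩ := h N hN
  obtain ⟨N'', hN'', h2, -⟩ := hN'.exists_insert u v
  exact ⟨N'', hN'', by rw [card_insert_pick huv]; omega⟩

theorem LosesAtMost.pick_of_unique [DecidableEq V] {G : SimpleGraph V} {M : Finset (Sym2 V)}
    {p : ℕ} (h : LosesAtMost G M p) {u v : V} (huv : (reduced G M).Adj u v)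
    (hu : ∀ x, (reduced G M).Adj u x → x = v) :
    LosesAtMost G (insert s(u, v) M) p := fun N hN => by
  obtain ⟨N', hN', hle⟩ := h N hN
  obtain ⟨N'', hN'', -, h1⟩ := hN'.exists_insert u v
  have := h1 hu
  exact ⟨N'', hN'', by rw [card_insert_pick huv]; omega⟩

theorem LosesAtMost.card_le {G : SimpleGraph V} {M : Finset (Sym2 V)} {p : ℕ}
    (h : LosesAtMost G M p) (hbot : reduced G M = ⊥) {N : Finset (Sym2 V)}
    (hN : IsEdgeMatching G N) : N.card ≤ M.card + p := by
  obtain ⟨N', hN', hle⟩ := h N hN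
  rw [hbot] at hN'
  have : N' = ∅ := Finset.eq_empty_of_forall_notMem fun e he => by simpa using hN'.1 e he
  simpa [this] using hle

/-- The degree of a node, not depending on decidability. -/
noncomputable def deg (H : SimpleGraph V) (w : V) : ℕ := (H.neighborSet w).ncard

theorem degree_eq_deg (H : SimpleGraph V) (w : V) [Fintype (H.neighborSet w)] :
    H.degree w = deg H w := by
  rw [deg, Set.ncard_eq_toFinset_card', ← SimpleGraph.card_neighborSet_eq_degree,
    Set.toFinset_card]

theorem deg_pos_of_adj [Fintype V] {H : SimpleGraph V} {u v : V} (h : H.Adj u v) : 0 < deg H u :=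
  (Set.ncard_pos (Set.toFinite _)).2 ⟨v, h⟩

theorem eq_of_deg_eq_one {H : SimpleGraph V} {u v x : V} (h : deg H u = 1) (hv : H.Adj u v)
    (hx : H.Adj u x) : x = v := by
  obtain ⟨a, ha⟩ := Set.ncard_eq_one.1 h
  have hv' : v ∈ H.neighborSet u := hv
  have hx' : x ∈ H.neighborSet u := hx
  rw [ha] at hv' hx'
  exact hx'.trans hv'.symm

theorem deg_reduced_le [Fintype V] (G : SimpleGraph V) (M : Finset (Sym2 V)) (w : V) :
    deg (reduced G M) w ≤ deg G w :=
  Set.ncard_le_ncard (fun _ h => h.1) (Set.toFinite _)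

open Classical in
/-- The uncovered nodes without neighbors in the reduced graph: they remain uncovered. -/
noncomputable def dead [Fintype V] (G : SimpleGraph V) (M : Finset (Sym2 V)) : Finset V :=
  Finset.univ.filter fun w => Uncovered M w ∧ deg (reduced G M) w = 0

theorem mem_dead [Fintype V] {G : SimpleGraph V} {M : Finset (Sym2 V)} {w : V} :
    w ∈ dead G M ↔ Uncovered M w ∧ deg (reduced G M) w = 0 := by
  simp [dead]

/-- The number of dead nodes of colour `c`. -/
noncomputable def deadCount [Fintype V] {G : SimpleGraph V} (f : G.Coloring (Fin 2))
    (M : Finset (Sym2 V)) (c : Fin 2) : ℕ :=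
  ((dead G M).filter fun w => f w = c).card

theorem sum_deadCount [Fintype V] {G : SimpleGraph V} (f : G.Coloring (Fin 2))
    (M : Finset (Sym2 V)) : ∑ c, deadCount f M c = (dead G M).card :=
  (Finset.card_eq_sum_card_fiberwise fun _ _ => Finset.mem_univ _).symm

theorem eq_or_eq_of_adj {G : SimpleGraph V} {f : G.Coloring (Fin 2)} {u v : V}
    (huv : G.Adj u v) (c : Fin 2) : c = f u ∨ c = f v := by
  have := f.valid huv
  omega

end General

/-! ### Effect of one pick on dead nodes and deficits, per colour -/

section Counting

variable {V : Type*} [Fintype V] [DecidableEq V]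

open Classical in
/-- The nodes covered by the edges in `M`. -/
noncomputable def covered (M : Finset (Sym2 V)) : Finset V :=
  Finset.univ.filter fun w => ¬ Uncovered M w

theorem covered_eq_biUnion (M : Finset (Sym2 V)) : covered M = M.biUnion Sym2.toFinset := by
  ext w
  simp [covered, Uncovered]

theorem card_covered_le (M : Finset (Sym2 V)) : (covered M).card ≤ 2 * M.card := by
  rw [covered_eq_biUnion, mul_comm]
  refine Finset.card_biUnion_le_card_mul _ _ _ fun e _ => ?_
  rw [Sym2.card_toFinset]
  split_ifs <;> omega

theorem IsEdgeMatching.card_covered {G : SimpleGraph V} {M : Finset (Sym2 V)}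
    (h : IsEdgeMatching G M) : (covered M).card = 2 * M.card := by
  rw [covered_eq_biUnion, Finset.card_biUnion, mul_comm]
  · exact Finset.sum_const_nat fun e he =>
      Sym2.card_toFinset_of_not_isDiag _ (G.not_isDiag_of_mem_edgeSet (h.1 e he))
  · intro e he e' he' hne
    refine Finset.disjoint_left.2 fun w hw hw' => hne ?_
    exact h.2 e he e' he' w (Sym2.mem_toFinset.1 hw) (Sym2.mem_toFinset.1 hw')

/-- A matching of the reduced graph does not cover dead nodes. -/
theorem IsEdgeMatching.card_dead_le {G : SimpleGraph V} {M N : Finset (Sym2 V)}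
    (hM : IsEdgeMatching G M) (hN : IsEdgeMatching (reduced G M) N) :
    2 * (M.card + N.card) + (dead G M).card ≤ Fintype.card V := by
  obtain ⟨hU, hdisj⟩ := hM.union hN
  rw [← Finset.card_union_of_disjoint hdisj, ← hU.card_covered,
    ← Finset.card_union_of_disjoint]
  · exact Finset.card_le_univ _
  · refine Finset.disjoint_left.2 fun w hw hd => ?_
    rw [mem_dead] at hd
    rw [covered_eq_biUnion] at hw
    obtain ⟨e, he, hwe⟩ := Finset.mem_biUnion.1 hw
    rw [Sym2.mem_toFinset] at hwe
    rcases Finset.mem_union.1 he with he | he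
    · exact hd.1 e he hwe
    · obtain ⟨a, rfl⟩ := Sym2.mem_iff_exists.1 hwe
      have := deg_pos_of_adj (SimpleGraph.mem_edgeSet _ |>.1 (hN.1 _ he))
      omega

theorem card_le_of_reduced_eq_bot {G : SimpleGraph V} {M : Finset (Sym2 V)}
    (h : reduced G M = ⊥) : Fintype.card V ≤ 2 * M.card + (dead G M).card := by
  have hsub : (Finset.univ : Finset V) ⊆ covered M ∪ dead G M := by
    intro w _
    by_cases hw : Uncovered M w
    · refine Finset.mem_union_right _ (mem_dead.2 ⟨hw, ?_⟩)
      have : (reduced G M).neighborSet w = ∅ := by rw [h]; ext; simp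
      rw [deg, this, Set.ncard_empty]
    · exact Finset.mem_union_left _ (by simp [covered, hw])
  have h1 := (Finset.card_le_card hsub).trans (Finset.card_union_le _ _)
  have h2 := card_covered_le M
  rw [Finset.card_univ] at h1
  omega

variable {G : SimpleGraph V} (f : G.Coloring (Fin 2)) (M : Finset (Sym2 V))

open Classical in
/-- The total amount by which the degrees of the uncovered nodes of colour `c` fall short
of two. -/
noncomputable def deficit (c : Fin 2) : ℕ :=
  ∑ w, if f w = c ∧ Uncovered M w then 2 - deg (reduced G M) w else 0

theorem deadCount_eq_sum (c : Fin 2) :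
    deadCount f M c = ∑ w, if f w = c ∧ w ∈ dead G M then 1 else 0 := by
  rw [deadCount, ← Finset.card_filter]
  congr 1
  ext w
  simp [and_comm]

theorem two_mul_deadCount_le (c : Fin 2) : 2 * deadCount f M c ≤ deficit f M c := by
  rw [deadCount_eq_sum, Finset.mul_sum]
  refine Finset.sum_le_sum fun w _ => ?_
  by_cases hw : f w = c ∧ w ∈ dead G M
  · have h := mem_dead.1 hw.2
    simp [if_pos hw, if_pos (And.intro hw.1 h.1), h.2]
  · rw [if_neg hw]
    exact Nat.zero_le _

variable {M}

theorem deficit_le_of_forall_deg_ne_one (h : ∀ w, deg (reduced G M) w ≠ 1) (c : Fin 2) :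
    deficit f M c ≤ 2 * deadCount f M c := by
  rw [deadCount_eq_sum, Finset.mul_sum]
  refine Finset.sum_le_sum fun w _ => ?_
  have := h w
  by_cases hw : f w = c ∧ Uncovered M w
  · by_cases h0 : deg (reduced G M) w = 0
    · simp [mem_dead, hw, h0]
    · rw [if_pos hw]
      omega
  · rw [if_neg hw]
    omega

variable {f} {u v : V}

open Classical in
/-- Picking `uv` lowers the degree of a node with the colour of `u` only if it is a neighbor
of `v`, and then only by one. -/
theorem deg_le_deg_insert (huv : (reduced G M).Adj u v) {w : V} (hc : f w = f u)
    (hw : Uncovered (insert s(u, v) M) w) :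
    deg (reduced G M) w ≤ deg (reduced G (insert s(u, v) M)) w +
      if (reduced G M).Adj v w then 1 else 0 := by
  have key : ∀ x, (reduced G M).Adj w x → x ≠ v →
      (reduced G (insert s(u, v) M)).Adj w x := by
    intro x hx hxv
    have hxu : x ≠ u := by
      rintro rfl
      exact f.valid hx.1 hc
    exact reduced_adj.2 ⟨hx.1, hw, uncovered_insert.2 ⟨hxu, hxv, hx.2.2⟩⟩
  split_ifs with h
  · refine (Set.ncard_le_ncard (t := insert v _) (fun x hx => ?_) (Set.toFinite _)).trans
      (Set.ncard_insert_le v _)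
    by_cases hxv : x = v
    · exact Or.inl hxv
    · exact Or.inr (key x hx hxv)
  · refine Set.ncard_le_ncard (fun x hx => key x hx ?_) (Set.toFinite _)
    rintro rfl
    exact h (SimpleGraph.Adj.symm hx)

open Classical in
theorem card_neighbors_ne (huv : (reduced G M).Adj u v) :
    (Finset.univ.filter fun w => (reduced G M).Adj v w ∧ w ≠ u).card + 1 =
      deg (reduced G M) v := by
  have : (Finset.univ.filter fun w => (reduced G M).Adj v w ∧ w ≠ u) =
      ((reduced G M).neighborSet v).toFinset.erase u := by
    ext w
    simp [and_comm]
  rw [this, Finset.card_erase_add_one (by simpa using huv.symm), deg,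
    Set.ncard_eq_toFinset_card']

open Classical in
-- Each of the `deg v - 1` neighbors of `v` other than `u` loses one degree. The node `u` becomes
-- covered and takes its own deficit with it, which is one if `u` had degree one; this saving turns
-- `e + 1` into `e`.
theorem deficit_insert_le (huv : (reduced G M).Adj u v) :
    deficit f (insert s(u, v) M) (f u) + (if deg (reduced G M) u = 1 then 1 else 0) + 1 ≤
      deficit f M (f u) + deg (reduced G M) v := by
  rw [← card_neighbors_ne huv, ← add_assoc, Finset.card_filter, deficit, deficit,
    ← Finset.sum_add_distrib, Nat.add_le_add_iff_right]
  -- The contribution of `u` is written as a sum over all nodes, so that the inequality can be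
  -- checked node by node.
  have hone := Finset.sum_ite_eq' Finset.univ u fun _ =>
    if deg (reduced G M) u = 1 then 1 else 0
  rw [if_pos (Finset.mem_univ u)] at hone
  rw [← hone, ← Finset.sum_add_distrib]
  refine Finset.sum_le_sum fun w _ => ?_
  by_cases hwu : w = u
  · subst hwu
    have h1 : ¬ Uncovered (insert s(w, v) M) w := by simp [uncovered_insert]
    have h2 : Uncovered M w := huv.2.1
    simp only [h1, h2]
    split_ifs <;> simp_all
  · by_cases hw : f w = f u ∧ Uncovered (insert s(u, v) M) w
    · have h1 := deg_le_deg_insert huv hw.1 hw.2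
      have h2 : f w = f u ∧ Uncovered M w := ⟨hw.1, (uncovered_insert.1 hw.2).2.2⟩
      rw [if_pos hw, if_pos h2, if_neg hwu]
      by_cases hvw : (reduced G M).Adj v w
      · rw [if_pos hvw] at h1
        rw [if_pos ⟨hvw, hwu⟩]
        omega
      · rw [if_neg hvw] at h1
        omega
    · rw [if_neg hw, if_neg hwu]
      omega

theorem deadCount_insert_le (huv : (reduced G M).Adj u v) :
    deadCount f (insert s(u, v) M) (f u) + 1 ≤
      deadCount f M (f u) + deg (reduced G M) v := by
  classical
  rw [← card_neighbors_ne huv, ← add_assoc, Nat.add_le_add_iff_right]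
  refine (Finset.card_le_card fun w hw => ?_).trans (Finset.card_union_le _ _)
  simp only [Finset.mem_filter, mem_dead, Finset.mem_union, Finset.mem_univ, true_and] at hw ⊢
  obtain ⟨⟨hw, h0⟩, hc⟩ := hw
  have h1 := deg_le_deg_insert huv hc hw
  obtain ⟨hwu, -, hwM⟩ := uncovered_insert.1 hw
  by_cases hvw : (reduced G M).Adj v w
  · exact Or.inr ⟨hvw, hwu⟩
  · rw [if_neg hvw] at h1
    exact Or.inl ⟨⟨hwM, by omega⟩, hc⟩

/-- A node that is not yet dead has degree at least two and loses at most one, so a free pick kills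
nothing. -/
theorem deadCount_insert_le_of_forall_deg_ne_one (huv : (reduced G M).Adj u v)
    (h : ∀ w, deg (reduced G M) w ≠ 1) :
    deadCount f (insert s(u, v) M) (f u) ≤ deadCount f M (f u) := by
  classical
  refine Finset.card_le_card fun w hw => ?_
  simp only [Finset.mem_filter, mem_dead] at hw ⊢
  obtain ⟨⟨hw, h0⟩, hc⟩ := hw
  have h1 := deg_le_deg_insert huv hc hw
  have h2 := h w
  refine ⟨⟨(uncovered_insert.1 hw).2.2, ?_⟩, hc⟩
  split_ifs at h1 <;> omega

end Counting

/-! ### Amortized bound on the dead nodes of one colour -/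

section Balance

/-- Bookkeeping for the nodes of one colour: `d` of them are dead, `φ` is their deficit, `a` of
them died before the first pick without a node of degree one, and `m` nodes of degree one were
picked since. The witness `b` is the number of dead nodes at the last pick without a node of
degree one, and `l` nodes of degree one were picked since that pick. -/
def Balanced (e d φ a m : ℕ) : Prop :=
  ∃ b n l, b ≤ a + e * n ∧ m = n + l ∧ φ + l ≤ 2 * b + (l + 1) * (e + 1) ∧ d ≤ b + l * (e + 1)

variable {e d φ a m d' φ' : ℕ}

theorem Balanced.le (h : Balanced e d φ a m) (hd : 2 * d ≤ φ) : d ≤ a + e * m := by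
  obtain ⟨b, n, l, hb, rfl, hφ, hl⟩ := h
  suffices d ≤ b + e * l by rw [mul_add]; omega
  -- For `l = 0` nothing has died since the free pick. For `l = 1` the deficit gives `2 * d ≤ 2 * b
  -- + 2 * e + 1`, and parity removes the excess. For larger `l`, `2 * d ≤ 2 * b + (e + 1) + l * e`
  -- suffices if `e ≥ 1`; for `e = 0` parity is used again.
  rcases l with _ | _ | l
  · simpa using hl
  · omega
  · rcases e with _ | e
    · omega
    · have : 0 ≤ e * l := Nat.zero_le _
      have h3 : (l + 2 + 1) * (e + 1 + 1) = e * l + 2 * l + 3 * e + 6 := by ring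
      have h4 : (e + 1) * (l + 2) = e * l + l + 2 * e + 2 := by ring
      rw [h4]
      rw [add_assoc l 1 1, h3] at hφ
      omega

theorem Balanced.pick (h : Balanced e d φ a m) (hφ : φ' + 1 ≤ φ + (e + 1))
    (hd : d' ≤ d + (e + 1)) : Balanced e d' φ' a (m + 1) := by
  obtain ⟨b, n, l, hb, rfl, h1, h2⟩ := h
  refine ⟨b, n, l + 1, hb, by ring, ?_, ?_⟩
  · rw [add_mul (l + 1)]
    omega
  · rw [add_mul]
    omega

theorem Balanced.mono (h : Balanced e d φ a m) (hφ : φ' ≤ φ) (hd : d' ≤ d) :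
    Balanced e d' φ' a m := by
  obtain ⟨b, n, l, hb, rfl, h1, h2⟩ := h
  exact ⟨b, n, l, hb, rfl, by omega, by omega⟩

/-- At a free pick the bound reached so far becomes the new base: `b = d`, `n = m`, `l = 0`. -/
theorem Balanced.restart (h : d ≤ a + e * m) (hφ : φ' ≤ 2 * d + (e + 1)) (hd : d' ≤ d) :
    Balanced e d' φ' a m :=
  ⟨d, m, 0, h, rfl, by omega, by omega⟩

end Balance

/-! ### The invariant of Karp–Sipser runs and the final estimate -/

section Main

variable {V : Type*} [Fintype V] [DecidableEq V] {G : SimpleGraph V}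

/-- Bookkeeping for a state of the Karp–Sipser algorithm: `p` picks were made when there was no
node of degree one. -/
def Accounted (e : ℕ) (f : G.Coloring (Fin 2)) (M : Finset (Sym2 V)) : Prop :=
  ∃ (p : ℕ) (a m : Fin 2 → ℕ), LosesAtMost G M p ∧
    (∀ N, IsEdgeMatching G N → 2 * N.card + ∑ c, a c ≤ Fintype.card V) ∧
    p + ∑ c, m c ≤ M.card ∧ ∀ c, Balanced e (deadCount f M c) (deficit f M c) (a c) (m c)

variable {e : ℕ} {f : G.Coloring (Fin 2)} {M : Finset (Sym2 V)} {u v : V}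

theorem Accounted.pick_of_deg_eq_one (h : Accounted e f M) (hdeg : ∀ w, deg G w ≤ e + 2)
    (huv : (reduced G M).Adj u v) (hu : deg (reduced G M) u = 1) :
    Accounted e f (insert s(u, v) M) := by
  obtain ⟨p, a, m, hp, ha, hm, hb⟩ := h
  refine ⟨p, a, Function.update m (f u) (m (f u) + 1),
    hp.pick_of_unique huv fun x hx => eq_of_deg_eq_one hu huv hx, ha, ?_, fun c => ?_⟩
  · rw [card_insert_pick huv, Finset.sum_update_of_mem (Finset.mem_univ _)]
    have := Finset.add_sum_erase Finset.univ m (Finset.mem_univ (f u))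
    rw [Finset.sdiff_singleton_eq_erase]
    omega
  · have hv := (deg_reduced_le G M v).trans (hdeg v)
    rcases eq_or_eq_of_adj (f := f) huv.1 c with rfl | rfl
    · rw [Function.update_self]
      have h1 := deficit_insert_le (f := f) huv
      have h2 := deadCount_insert_le (f := f) huv
      rw [if_pos hu] at h1
      exact (hb _).pick (by omega) (by omega)
    -- In the colour of `v` only neighbors of `u` could suffer, and `v` is the only one.
    · rw [Function.update_of_ne (f.valid huv.1).symm]
      have h1 := deficit_insert_le (f := f) huv.symm
      have h2 := deadCount_insert_le (f := f) huv.symm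
      rw [Sym2.eq_swap] at h1 h2
      exact (hb _).mono (by omega) (by omega)

theorem balanced_insert {a m : ℕ} {c : Fin 2} (hdeg : ∀ w, deg G w ≤ e + 2)
    (huv : (reduced G M).Adj u v) (hne : ∀ w, deg (reduced G M) w ≠ 1)
    (h : deadCount f M c ≤ a + e * m) :
    Balanced e (deadCount f (insert s(u, v) M) c) (deficit f (insert s(u, v) M) c) a m := by
  have key : ∀ x y, (reduced G M).Adj x y → c = f x →
      Balanced e (deadCount f (insert s(x, y) M) c) (deficit f (insert s(x, y) M) c) a m := by
    rintro x y hxy rfl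
    have h1 := deficit_insert_le (f := f) hxy
    have h2 := deadCount_insert_le_of_forall_deg_ne_one (f := f) hxy hne
    have h3 := deficit_le_of_forall_deg_ne_one f hne (f x)
    have h4 := (deg_reduced_le G M y).trans (hdeg y)
    exact .restart h (by omega) h2
  rcases eq_or_eq_of_adj (f := f) huv.1 c with hc | hc
  · exact key u v huv hc
  · have := key v u huv.symm hc
    rwa [Sym2.eq_swap] at this

theorem Accounted.pick (h : Accounted e f M) (hdeg : ∀ w, deg G w ≤ e + 2)
    (huv : (reduced G M).Adj u v) (hne : ∀ w, deg (reduced G M) w ≠ 1) :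
    Accounted e f (insert s(u, v) M) := by
  obtain ⟨p, a, m, hp, ha, hm, hb⟩ := h
  refine ⟨p + 1, a, m, hp.pick huv, ha, ?_, fun c =>
    balanced_insert hdeg huv hne ((hb c).le (two_mul_deadCount_le f M c))⟩
  rw [card_insert_pick huv]
  omega

/-- The first free pick fixes `a` as the current dead counts. As no edge has been lost so far, `N`
has a replacement that, together with `M`, avoids all dead nodes. -/
theorem LosesAtMost.accounted_pick (h : LosesAtMost G M 0) (hM : IsEdgeMatching G M)
    (hdeg : ∀ w, deg G w ≤ e + 2)
    (huv : (reduced G M).Adj u v) (hne : ∀ w, deg (reduced G M) w ≠ 1) :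
    Accounted e f (insert s(u, v) M) := by
  refine ⟨1, deadCount f M, 0, h.pick huv, fun N hN => ?_, ?_, fun c =>
    balanced_insert hdeg huv hne (by simp)⟩
  · obtain ⟨N', hN', hle⟩ := h N hN
    have := hM.card_dead_le hN'
    rw [sum_deadCount]
    omega
  · rw [card_insert_pick huv]
    simp

theorem Reachable.invariant (hdeg : ∀ w, deg G w ≤ e + 2)
    (h : Reachable karpSipser G M) :
    IsEdgeMatching G M ∧ (LosesAtMost G M 0 ∨ Accounted e f M) := by
  induction h with
  | start => exact ⟨isEdgeMatching_empty G, Or.inl (losesAtMost_empty G)⟩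
  | @pick M u v _ hr ih =>
    obtain ⟨huv, hks⟩ := hr
    simp only [degree_eq_deg] at hks
    refine ⟨ih.1.insert_pick huv, ?_⟩
    by_cases hone : deg (reduced G M) u = 1 ∨ deg (reduced G M) v = 1
    · have key : ∀ x y, (reduced G M).Adj x y → deg (reduced G M) x = 1 →
          LosesAtMost G (insert s(x, y) M) 0 ∨
            Accounted e f (insert s(x, y) M) := fun x y hxy hx =>
        ih.2.imp (fun h => h.pick_of_unique hxy fun z hz => eq_of_deg_eq_one hx hxy hz)
          fun h => h.pick_of_deg_eq_one hdeg hxy hx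
      rcases hone with hu | hv
      · exact key u v huv hu
      · have := key v u huv.symm hv
        rwa [Sym2.eq_swap] at this
    · have hne : ∀ w, deg (reduced G M) w ≠ 1 := fun w hw => hone (hks ⟨w, hw⟩)
      exact Or.inr (ih.2.elim (fun h => h.accounted_pick ih.1 hdeg huv hne)
        fun h => h.pick hdeg huv hne)

theorem Output.card_bound (f : G.Coloring (Fin 2)) (hdeg : ∀ w, deg G w ≤ e + 2)
    (h : Output karpSipser G M) {N : Finset (Sym2 V)} (hN : IsEdgeMatching G N) :
    (e + 2) * N.card ≤ (2 * e + 2) * M.card := by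
  rcases (h.1.invariant (f := f) hdeg).2 with h0 | ⟨p, a, m, hp, ha, hm, hb⟩
  · exact Nat.mul_le_mul (by omega) (h0.card_le h.2 hN)
  · have h1 := hp.card_le h.2 hN
    have h2 := ha N hN
    have h3 := card_le_of_reduced_eq_bot h.2
    have h4 : (dead G M).card ≤ ∑ c, a c + e * ∑ c, m c := by
      rw [← sum_deadCount f M, Finset.mul_sum, ← Finset.sum_add_distrib]
      exact Finset.sum_le_sum fun c _ => (hb c).le (two_mul_deadCount_le f M c)
    -- The result is the sum of `h2`, `h3`, `h4`, twice `h5`'s underlying bound scaled by `e / 2`,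
    -- and `h6`.
    have h5 := Nat.mul_le_mul_left e h1
    have h6 := Nat.mul_le_mul_left e hm
    nlinarith

end Main

end GreedyMatching

theorem theorem1 {V : Type*} [Fintype V] [DecidableEq V] (G : SimpleGraph V)
    [DecidableRel G.Adj] (Δ : ℕ) (hΔ : 2 ≤ Δ) (hbip : G.IsBipartite)
    (hdeg : ∀ v, G.degree v ≤ Δ) :
    GreedyMatching.Guarantees GreedyMatching.karpSipser G ((Δ : ℚ) / (2 * (Δ : ℚ) - 2)) ∧
      GreedyMatching.Guarantees GreedyMatching.minGreedy G ((Δ : ℚ) / (2 * (Δ : ℚ) - 2)) := by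
  open GreedyMatching in
  obtain ⟨e, rfl⟩ := Nat.exists_eq_add_of_le' hΔ
  obtain ⟨f⟩ := hbip
  have hdeg' : ∀ w, deg G w ≤ e + 2 := fun w => by
    rw [← degree_eq_deg]
    exact hdeg w
  have main : ∀ M, Output karpSipser G M → IsMatchingOf G M ∧
      ∀ N : Finset (Sym2 V), IsMatchingOf G N →
        ((e + 2 : ℕ) : ℚ) / (2 * ((e + 2 : ℕ) : ℚ) - 2) * N.card ≤ M.card := by
    intro M hM
    refine ⟨(hM.1.invariant (f := f) hdeg').1.isMatchingOf, fun N hN => ?_⟩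
    have h : ((e + 2 : ℕ) : ℚ) * N.card ≤ (2 * e + 2 : ℕ) * M.card := by
      exact_mod_cast hM.card_bound f hdeg' hN.isEdgeMatching
    have hpos : (0 : ℚ) < 2 * ((e + 2 : ℕ) : ℚ) - 2 := by
      push_cast
      linarith [(Nat.cast_nonneg e : (0 : ℚ) ≤ e)]
    rw [div_mul_eq_mul_div, div_le_iff₀ hpos]
    push_cast at h ⊢
    linarith
  refine ⟨⟨fun M hM => exists_output (fun H hH => ?_) (fun H u v h => h.1) hM, main⟩,
    ⟨fun M hM => exists_output (fun H hH => exists_minGreedy hH) (fun H u v h => h.1) hM,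
      fun M hM => main M ⟨hM.1.mono fun H u v h => h.karpSipser, hM.2⟩⟩⟩
  obtain ⟨u, v, h⟩ := exists_minGreedy hH
  exact ⟨u, v, h.karpSipser⟩
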